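/- Let $q$ be a power of an odd prime $p$, and let $\zeta_p\in\mathbb{C}$ be a primitive $p$-th root of unity. Let $\mathbb{C}^{q^n}\cong(\mathbb{C}^q)^{\otimes n}$ have orthonormal basis $\{|x\rangle : x\in\mathbb{F}_q^n\}$. For $a,b\in\mathbb{F}_q^n$ and $0\le l\le p-1$, the error $\zeta_p^{l}T^aR^b$ is the linear operator with $\zeta_p^{l}T^aR^b|x\rangle=\zeta_p^{\,l+\mathrm{Tr}_{\mathbb{F}_q/\mathbb{F}_p}(b\cdot x)}|x+a\rangle$, and its quantum weight is the number of $i$ with $(a_i,b_i)\ne(0,0)$. A subspace $Q\subseteq\mathbb{C}^{q^n}$ detects an error $E$ if there is $c\in\mathbb{C}$ with $\langle u|E|v\rangle=c\langle u|v\rangle$ for all $u,v\in Q$; it has minimum distance $\delta$ if it detects every error of quantum weight less than $\delta$ but fails to detect some error of quantum weight $\delta$. A $q$-ary $[[n,k,\ge d]]$ quantum code is a $q^k$-dimensional subspace of $\mathbb{C}^{q^n}$ with minimum distance $\delta$ for some $\delta\ge d$. Then the following hold. <ol> <li>For every even $d$ with $2\le d\le q+1$ there exists a $q$-ary $[[2q^2+2,\,2q^2+6-3d,\,\ge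 d]]$ quantum code.</li> <li>For every odd $d$ with $2\le d\le q+1$ there exists a $q$-ary $[[2q^2+2,\,2q^2+5-3d,\,\ge d]]$ quantum code.</li> <li>For every even $d$ with $2\le d\le q$ there exists a $q$-ary $[[2q^2,\,2q^2+4-3d,\,\ge d]]$ quantum code.</li> <li>For every odd $d$ with $2\le d\le q$ there exists a $q$-ary $[[2q^2,\,2q^2+3-3d,\,\ge d]]$ quantum code.</li> <li>For every even $d$ with $2\le d\le q$ there exists a $q$-ary $[[2q^2-2,\,2q^2+2-3d,\,\ge d]]$ quantum code.</li> <li>For every odd $d$ with $2\le d\le q$ there exists a $q$-ary $[[2q^2-2,\,2q^2+1-3d,\,\ge d]]$ quantum code.</li> </ol> -/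

import Mathlib

namespace QuantumCode

/-- The state space `(ℂ^q)^{⊗ n} ≅ ℂ^{q^n}` of `n` quantum digits over the finite field `F`:
the Hilbert space whose orthonormal basis `|x⟩` is indexed by the vectors `x ∈ F^n`. -/
abbrev State (F : Type*) [Fintype F] (n : ℕ) : Type _ :=
  EuclideanSpace ℂ (Fin n → F)

section

variable {F : Type*} [Field F] [Fintype F] {p : ℕ} [Fact p.Prime] [Algebra (ZMod p) F] {n : ℕ}

/-- The scalar `ζ ^ Tr(b · x)`, where `Tr` is the trace of `F` over `ZMod p` and
`b · x = ∑ i, b i * x i`. -/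
noncomputable def phase (p : ℕ) [Fact p.Prime] [Algebra (ZMod p) F] (ζ : ℂ)
    (b x : Fin n → F) : ℂ :=
  ζ ^ (Algebra.trace (ZMod p) F (∑ i, b i * x i)).val

/-- The error operator `ζ ^ l T^a R^b`, determined by
`ζ ^ l T^a R^b |x⟩ = ζ ^ (l + Tr(b · x)) |x + a⟩` (see `errorOp_single`).
In coordinates, the coefficient at `|y⟩` of the image of `v` is
`ζ ^ l * ζ ^ Tr(b · (y - a))` times the coefficient of `v` at `|y - a⟩`. -/
noncomputable def errorOp (p : ℕ) [Fact p.Prime] [Algebra (ZMod p) F] (ζ : ℂ) (l : Fin p)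
    (a b : Fin n → F) : State F n →ₗ[ℂ] State F n where
  toFun v := WithLp.toLp 2 fun y => ζ ^ (l : ℕ) * phase p ζ b (y - a) * v (y - a)
  map_add' u v := by
    ext y
    simp [mul_add]
  map_smul' c v := by
    ext y
    simp
    ring

/-- The defining formula of the error operators on the basis vectors. -/
theorem errorOp_single [DecidableEq F] (ζ : ℂ) (l : Fin p) (a b x : Fin n → F) :
    errorOp p ζ l a b (EuclideanSpace.single x 1) =
      (ζ ^ (l : ℕ) * phase p ζ b x) • EuclideanSpace.single (x + a) (1 : ℂ) := by
  ext y
  by_cases h : y = x + a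
  · subst h
    simp [errorOp]
  · have h2 : y - a ≠ x := fun h3 => h (by rw [← h3]; simp)
    simp [errorOp, h, h2]

/-- The quantum weight of `ζ ^ l T^a R^b`: the number of positions `i` with
`(a i, b i) ≠ (0, 0)`. -/
noncomputable def quantumWeight (a b : Fin n → F) : ℕ :=
  {i : Fin n | (a i, b i) ≠ (0, 0)}.ncard

/-- The code `Q` detects the error `E`: there is a scalar `c` with
`⟨u | E | v⟩ = c ⟨u | v⟩` for all `u, v ∈ Q` (that is, `P E P = c P` for the orthogonal
projection `P` onto `Q`). -/
def Detects (Q : Submodule ℂ (State F n)) (E : State F n →ₗ[ℂ] State F n) : Prop :=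
  ∃ c : ℂ, ∀ u ∈ Q, ∀ v ∈ Q, inner ℂ u (E v) = c * inner ℂ u v

/-- `Q` has minimum distance `d`: it detects every error of quantum weight less than `d`,
and fails to detect some error of quantum weight `d`. -/
def HasMinDist (p : ℕ) [Fact p.Prime] [Algebra (ZMod p) F] (ζ : ℂ)
    (Q : Submodule ℂ (State F n)) (d : ℕ) : Prop :=
  (∀ (l : Fin p) (a b : Fin n → F), quantumWeight a b < d → Detects Q (errorOp p ζ l a b)) ∧
    ∃ (l : Fin p) (a b : Fin n → F), quantumWeight a b = d ∧ ¬ Detects Q (errorOp p ζ l a b)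

/-- `Q` is an `[[n, k, d]]_q` quantum code, `q` being the number of elements of `F`:
a subspace of dimension `q ^ k` with minimum distance `d`. -/
def IsQuantumCode (p : ℕ) [Fact p.Prime] [Algebra (ZMod p) F] (ζ : ℂ) (k d : ℕ)
    (Q : Submodule ℂ (State F n)) : Prop :=
  Module.finrank ℂ Q = Fintype.card F ^ k ∧ HasMinDist p ζ Q d

end

/-- There is an `[[n, k, ≥ d]]_q` quantum code over the alphabet `F` with `q` elements:
an `[[n, k, δ]]_q` quantum code for some `δ ≥ d`. -/
def ExistsCodeGE (F : Type*) [Field F] [Fintype F] (p : ℕ) [Fact p.Prime]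
    [Algebra (ZMod p) F] (ζ : ℂ) (n k d : ℕ) : Prop :=
  ∃ (Q : Submodule ℂ (State F n)) (δ : ℕ), d ≤ δ ∧ IsQuantumCode p ζ k δ Q

end QuantumCode

/-! Everything is reduced to Hermitian self-orthogonal codes over the quadratic extension 𝕂 = F(ω),
ω² = ν a nonsquare, whose conjugation is x ↦ x^q.

Stabilizer codes: the ω-coordinate of the Hermitian product is the symplectic form, so a
κ-dimensional Hermitian self-orthogonal code gives a family of commuting error operators. Their
common fixed space has dimension q^(n - 2κ). An error outside the symplectic dual of the family is
detected, so the distance is at least that of the Hermitian dual (`existsCodeGE_of_isotropic`,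
`IsHermitianCode.existsCodeGE`).

Doubling: {(u + v | u - v)} keeps self-orthogonality, adds dimensions, and has dual distance at
least min(2 d₁, d₂) (`IsHermitianCode.matrixProduct`). With MDS ingredients of dimensions ⌊(d -
1)/2⌋ and d - 1, the loss 2κ is 3d - 4 for even d and 3d - 3 for odd d.

MDS ingredients: Reed–Solomon codes on the projective line over 𝕂, of length q² + 1, q² or q² - 1.
The norm 𝕂 → F is onto, so column multipliers may realize any F-valued weights w. Self-orthogonality
then says that the w-weighted sums of x^(i + qj) vanish for i, j < κ. The weights are chosen with
prescribed zeros so that only power sums of small exponent occur, or a single sum -1 that the point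
at infinity cancels. -/

open Module

namespace QuantumCode

/-! ### Error operators and stabilizer projections. -/

section Symplectic

variable {F : Type*} [Field F] {n : ℕ}

/-- The symplectic form on `F^n × F^n`. -/
def symp (s t : (Fin n → F) × (Fin n → F)) : F := t.1 ⬝ᵥ s.2 - s.1 ⬝ᵥ t.2

theorem symp_smul_left (c : F) (s t : (Fin n → F) × (Fin n → F)) :
    symp (c • s) t = c * symp s t := by
  simp [symp, mul_sub]

end Symplectic

section Weyl

variable {F : Type*} [Field F] [Fintype F] {n : ℕ}

/-- The symmetrically normalized error operator
`|x⟩ ↦ χ (b · x + (a · b) / 2) |x + a⟩` attached to `s = (a, b)`. -/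
noncomputable def weyl (χ : AddChar F ℂ) (s : (Fin n → F) × (Fin n → F)) :
    State F n →ₗ[ℂ] State F n where
  toFun v := WithLp.toLp 2 fun y => χ (s.2 ⬝ᵥ (y - s.1) + s.1 ⬝ᵥ s.2 / 2) * v (y - s.1)
  map_add' u v := by
    ext y
    simp [mul_add]
  map_smul' c v := by
    ext y
    simp
    ring

theorem weyl_apply (χ : AddChar F ℂ) (s : (Fin n → F) × (Fin n → F)) (v : State F n)
    (y : Fin n → F) :
    weyl χ s v y = χ (s.2 ⬝ᵥ (y - s.1) + s.1 ⬝ᵥ s.2 / 2) * v (y - s.1) := rfl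

theorem weyl_zero (χ : AddChar F ℂ) : weyl χ (0 : (Fin n → F) × (Fin n → F)) = LinearMap.id := by
  ext v y
  simp [weyl_apply]

/-- The half in the phase of `weyl` makes the cocycle alternating. Hence `weyl` is multiplicative on
an isotropic subspace, with no signs or phases to choose. -/
theorem weyl_weyl (h2 : (2 : F) ≠ 0) (χ : AddChar F ℂ) (s t : (Fin n → F) × (Fin n → F))
    (v : State F n) : weyl χ s (weyl χ t v) = χ (symp s t / 2) • weyl χ (s + t) v := by
  ext y
  simp only [weyl_apply, PiLp.smul_apply, smul_eq_mul, ← mul_assoc, ← AddChar.map_add_eq_mul]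
  congr 2
  · simp only [symp, Prod.fst_add, Prod.snd_add, dotProduct_sub, sub_dotProduct, add_dotProduct, dotProduct_add,
      dotProduct_comm s.2, dotProduct_comm t.2]
    field_simp
    ring
  · simp [sub_sub]

theorem weyl_comm (h2 : (2 : F) ≠ 0) (χ : AddChar F ℂ) (s t : (Fin n → F) × (Fin n → F))
    (v : State F n) : weyl χ s (weyl χ t v) = χ (symp s t) • weyl χ t (weyl χ s v) := by
  rw [weyl_weyl h2, weyl_weyl h2, smul_smul, ← AddChar.map_add_eq_mul, add_comm t s]
  congr 2
  simp only [symp]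
  field_simp
  ring

theorem inner_weyl (χ : AddChar F ℂ) (s : (Fin n → F) × (Fin n → F)) (u v : State F n) :
    inner ℂ (weyl χ s u) (weyl χ s v) = inner ℂ u v := by
  simp only [PiLp.inner_apply, weyl_apply]
  refine Fintype.sum_equiv (Equiv.subRight s.1) _ _ fun y => ?_
  simp only [RCLike.inner_apply, map_mul, Equiv.subRight_apply]
  have h := RCLike.mul_conj (χ (s.2 ⬝ᵥ (y - s.1) + s.1 ⬝ᵥ s.2 / 2))
  rw [AddChar.norm_apply, RCLike.ofReal_one, one_pow] at h
  linear_combination (v (y - s.1) * (starRingEnd ℂ) (u (y - s.1))) * h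

theorem sum_char_dotProduct {χ : AddChar F ℂ} (hχ : χ ≠ 1) {b : Fin n → F} (hb : b ≠ 0) :
    ∑ x : Fin n → F, χ (b ⬝ᵥ x) = 0 := by
  let ψ : AddChar (Fin n → F) ℂ :=
    { toFun := fun x => χ (b ⬝ᵥ x)
      map_zero_eq_one' := by simp
      map_add_eq_mul' := fun x y => by rw [dotProduct_add, AddChar.map_add_eq_mul] }
  refine AddChar.sum_eq_zero_of_ne_one (ψ := ψ) fun h => hχ ?_
  obtain ⟨i, hi⟩ := Function.ne_iff.1 hb
  classical
  ext z
  have h1 : ψ (Pi.single i ((b i)⁻¹ * z)) = 1 := by rw [h]; rfl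
  change χ (b ⬝ᵥ Pi.single i ((b i)⁻¹ * z)) = 1 at h1
  rwa [dotProduct_single, mul_inv_cancel_left₀ hi] at h1

theorem trace_weyl {χ : AddChar F ℂ} (hχ : χ ≠ 1) {s : (Fin n → F) × (Fin n → F)} (hs : s ≠ 0) :
    LinearMap.trace ℂ _ (weyl χ s) = 0 := by
  classical
  rw [LinearMap.trace_eq_sum_inner _ (EuclideanSpace.basisFun (Fin n → F) ℂ)]
  simp only [EuclideanSpace.basisFun_apply, EuclideanSpace.inner_single_left, weyl_apply]
  by_cases ha : s.1 = 0
  · have hb : s.2 ≠ 0 := fun hb => hs (Prod.ext ha hb)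
    simpa [ha] using sum_char_dotProduct hχ hb
  · refine Finset.sum_eq_zero fun x _ => ?_
    simp [ha]

/-- The average of the operators `weyl χ s` over `s ∈ S`. -/
noncomputable def stabProj (χ : AddChar F ℂ) (S : Submodule F ((Fin n → F) × (Fin n → F))) :
    State F n →ₗ[ℂ] State F n :=
  (Nat.card S : ℂ)⁻¹ • ∑ᶠ s : S, weyl χ (s : (Fin n → F) × (Fin n → F))

theorem stabProj_apply (χ : AddChar F ℂ)
    (S : Submodule F ((Fin n → F) × (Fin n → F))) [Fintype S] (v : State F n) :
    stabProj χ S v = (Nat.card S : ℂ)⁻¹ • ∑ s : S, weyl χ (s : (Fin n → F) × (Fin n → F)) v := by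
  simp [stabProj, finsum_eq_sum_of_fintype]

theorem weyl_stabProj (h2 : (2 : F) ≠ 0) (χ : AddChar F ℂ)
    {S : Submodule F ((Fin n → F) × (Fin n → F))} (hS : ∀ s ∈ S, ∀ t ∈ S, symp s t = 0)
    {s : (Fin n → F) × (Fin n → F)} (hs : s ∈ S) (v : State F n) :
    weyl χ s (stabProj χ S v) = stabProj χ S v := by
  have := Fintype.ofFinite S
  simp only [stabProj_apply, map_smul, map_sum]
  congr 1
  rw [← Equiv.sum_comp (Equiv.addLeft (⟨s, hs⟩ : S)) (fun t : S => weyl χ (t : _ × _) v)]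
  refine Finset.sum_congr rfl fun t _ => ?_
  rw [weyl_weyl h2, hS s hs t t.2]
  simp

theorem stabProj_of_fixed (χ : AddChar F ℂ)
    {S : Submodule F ((Fin n → F) × (Fin n → F))} {v : State F n}
    (hv : ∀ s ∈ S, weyl χ s v = v) : stabProj χ S v = v := by
  have := Fintype.ofFinite S
  rw [stabProj_apply, Finset.sum_congr rfl fun (s : S) _ => hv s s.2]
  simp [Finset.sum_const, ← Nat.cast_smul_eq_nsmul ℂ, smul_smul]

/-- The rank of a projection is its trace, and only the identity term of the average has nonzero
trace. -/
theorem finrank_range_stabProj (h2 : (2 : F) ≠ 0) {χ : AddChar F ℂ} (hχ : χ ≠ 1)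
    {S : Submodule F ((Fin n → F) × (Fin n → F))} (hS : ∀ s ∈ S, ∀ t ∈ S, symp s t = 0) :
    Fintype.card F ^ finrank F S * finrank ℂ (LinearMap.range (stabProj χ S)) =
      Fintype.card F ^ n := by
  have := Fintype.ofFinite S
  have hproj : LinearMap.IsProj (LinearMap.range (stabProj χ S)) (stabProj χ S) := by
    refine ⟨fun v => ⟨v, rfl⟩, ?_⟩
    rintro _ ⟨v, rfl⟩
    exact stabProj_of_fixed χ fun s hs => weyl_stabProj h2 χ hS hs v
  have ht := hproj.trace
  have htr : LinearMap.trace ℂ _ (stabProj χ S) = (Nat.card S : ℂ)⁻¹ * finrank ℂ (State F n) := by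
    rw [stabProj, finsum_eq_sum_of_fintype, map_smul, map_sum, Finset.sum_eq_single (0 : S),
      Submodule.coe_zero, weyl_zero, LinearMap.trace_id, smul_eq_mul]
    · intro s _ hs
      exact trace_weyl hχ fun h => hs (Subtype.ext h)
    · simp
  have hc : (Nat.card S : ℂ) ≠ 0 := by
    simp
  rw [htr, inv_mul_eq_iff_eq_mul₀ hc, Nat.card_eq_fintype_card,
    card_eq_pow_finrank (K := F) (V := S)] at ht
  norm_cast at ht
  rw [← ht]
  simp

/-- Moving `weyl χ s` across `weyl χ t` multiplies the inner product by a scalar other than 1 while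
leaving it unchanged. -/
theorem inner_weyl_eq_zero (h2 : (2 : F) ≠ 0) (χ : AddChar F ℂ)
    {s t : (Fin n → F) × (Fin n → F)} (hst : χ (symp s t) ≠ 1) {u v : State F n}
    (hu : weyl χ s u = u) (hv : weyl χ s v = v) : inner ℂ u (weyl χ t v) = 0 := by
  have h := inner_weyl χ s u (weyl χ t v)
  rw [weyl_comm h2, hu, hv, inner_smul_right] at h
  by_contra h0
  exact hst (mul_right_cancel₀ h0 (by rw [h, one_mul]))

end Weyl

/-! ### From isotropic subspaces to quantum codes. -/

section Codes

variable {F : Type*} [Field F] [Fintype F] {p : ℕ} [Fact p.Prime] [Algebra (ZMod p) F] {n : ℕ}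

/-- The additive character `x ↦ ζ ^ Tr x` of `F`. -/
noncomputable def traceChar (F : Type*) [Field F] [Fintype F] {p : ℕ} [Fact p.Prime]
    [Algebra (ZMod p) F] {ζ : ℂ} (hζ : IsPrimitiveRoot ζ p) : AddChar F ℂ :=
  (AddChar.zmodChar p hζ.pow_eq_one).compAddMonoidHom
    (Algebra.trace (ZMod p) F).toAddMonoidHom

theorem traceChar_apply {ζ : ℂ} (hζ : IsPrimitiveRoot ζ p) (x : F) :
    traceChar F hζ x = ζ ^ (Algebra.trace (ZMod p) F x).val := rfl

theorem traceChar_ne_one {ζ : ℂ} (hζ : IsPrimitiveRoot ζ p) : traceChar F hζ ≠ 1 := by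
  intro h
  have : FiniteDimensional (ZMod p) F := Module.Finite.of_finite
  obtain ⟨x, hx⟩ := Algebra.trace_surjective (ZMod p) F 1
  have h1 : traceChar F hζ x = 1 := by rw [h]; rfl
  have hp : 1 < p := (Fact.out : p.Prime).one_lt
  have : Fact (1 < p) := ⟨hp⟩
  rw [traceChar_apply, hx, ZMod.val_one, pow_one] at h1
  exact hζ.ne_one hp h1

theorem errorOp_eq_smul_weyl {ζ : ℂ} (hζ : IsPrimitiveRoot ζ p) (l : Fin p) (a b : Fin n → F) :
    errorOp p ζ l a b =
      (ζ ^ (l : ℕ) * traceChar F hζ (-(a ⬝ᵥ b / 2))) • weyl (traceChar F hζ) (a, b) := by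
  ext v y
  have h : phase p ζ b (y - a) = traceChar F hζ (-(a ⬝ᵥ b / 2)) *
      traceChar F hζ (b ⬝ᵥ (y - a) + a ⬝ᵥ b / 2) := by
    rw [← AddChar.map_add_eq_mul, neg_add_cancel_comm_assoc]
    rfl
  simp only [LinearMap.smul_apply, PiLp.smul_apply, weyl_apply, smul_eq_mul]
  rw [mul_assoc, ← mul_assoc (traceChar F hζ _), ← h, ← mul_assoc]
  rfl

/-- An error of quantum weight at most `n` goes undetected by a code of dimension at least two. -/
theorem exists_not_detects {ζ : ℂ} (hζ : IsPrimitiveRoot ζ p) {Q : Submodule ℂ (State F n)}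
    (hQ : 1 < finrank ℂ Q) :
    ∃ (l : Fin p) (a b : Fin n → F), ¬ Detects Q (errorOp p ζ l a b) := by
  classical
  by_contra! hdet
  have : Nontrivial Q := Module.nontrivial_of_finrank_pos (zero_lt_one.trans hQ)
  obtain ⟨u, hu⟩ := exists_ne (0 : Q)
  have hlt : (ℂ ∙ (u : State F n)) < Q := by
    refine lt_of_le_of_ne ((Submodule.span_singleton_le_iff_mem _ _).2 u.2) fun h => ?_
    have := finrank_span_singleton (K := ℂ) (v := (u : State F n)) (by simpa using hu)
    rw [h] at this
    omega
  obtain ⟨v, hvQ, hv, huv⟩ : ∃ v ∈ Q, v ≠ 0 ∧ inner ℂ (u : State F n) v = 0 := by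
    obtain ⟨w, hwQ, hw⟩ := SetLike.exists_of_lt hlt
    have hpr := Submodule.exists_add_mem_mem_orthogonal (K := ℂ ∙ (u : State F n)) w
    obtain ⟨y, hy, z, hz, rfl⟩ := hpr
    refine ⟨z, ?_, ?_, Submodule.mem_orthogonal_singleton_iff_inner_right.1 hz⟩
    · simpa using Q.sub_mem hwQ (hlt.le hy)
    · rintro rfl
      exact hw (by simpa using hy)
  obtain ⟨x, hx⟩ : ∃ x, (u : State F n) x ≠ 0 := by
    by_contra! h
    exact hu (Subtype.ext (by ext x; simpa using h x))
  obtain ⟨y, hy⟩ : ∃ y, v y ≠ 0 := by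
    by_contra! h
    exact hv (by ext x; simpa using h x)
  have hzero : ∀ b : Fin n → F,
      inner ℂ (u : State F n) (weyl (traceChar F hζ) (x - y, b) v) = 0 := by
    intro b
    obtain ⟨c, hc⟩ := hdet ⟨0, (Fact.out : p.Prime).pos⟩ (x - y) b
    have h := hc u u.2 v hvQ
    rw [errorOp_eq_smul_weyl hζ, huv, mul_zero, LinearMap.smul_apply, inner_smul_right] at h
    refine (mul_eq_zero.1 h).resolve_left (mul_ne_zero (by simp) ?_)
    intro h0
    have := AddChar.norm_apply (traceChar F hζ) (-((x - y) ⬝ᵥ b / 2))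
    rw [h0, norm_zero] at this
    exact zero_ne_one this
  -- Fourier inversion over `b` turns these operators into a multiple of the matrix unit |x⟩⟨y|,
  -- which sees the nonzero product of `u x` (conjugated) and `v y`.
  have hsum : ∑ b : Fin n → F, traceChar F hζ (-(b ⬝ᵥ y + (x - y) ⬝ᵥ b / 2)) *
      inner ℂ (u : State F n) (weyl (traceChar F hζ) (x - y, b) v) = 0 :=
    Finset.sum_eq_zero fun b _ => by rw [hzero, mul_zero]
  simp only [PiLp.inner_apply, weyl_apply, Finset.mul_sum] at hsum
  rw [Finset.sum_comm, Finset.sum_eq_single x] at hsum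
  · have h : ∀ b : Fin n → F, traceChar F hζ (-(b ⬝ᵥ y + (x - y) ⬝ᵥ b / 2)) *
        inner ℂ ((u : State F n) x) (traceChar F hζ (b ⬝ᵥ (x - (x - y)) + (x - y) ⬝ᵥ b / 2) *
          v (x - (x - y))) = inner ℂ ((u : State F n) x) (v y) := by
      intro b
      rw [sub_sub_cancel, ← smul_eq_mul (a := traceChar F hζ (b ⬝ᵥ y + _)), inner_smul_right,
        ← mul_assoc, ← AddChar.map_add_eq_mul, neg_add_cancel, AddChar.map_zero_eq_one, one_mul]
    rw [Finset.sum_congr rfl fun b _ => h b] at hsum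
    simp [hx, hy] at hsum
  · intro z _ hz
    have h : ∀ b : Fin n → F, traceChar F hζ (-(b ⬝ᵥ y + (x - y) ⬝ᵥ b / 2)) *
        inner ℂ ((u : State F n) z) (traceChar F hζ (b ⬝ᵥ (z - (x - y)) + (x - y) ⬝ᵥ b / 2) *
          v (z - (x - y))) = traceChar F hζ ((z - x) ⬝ᵥ b) *
            inner ℂ ((u : State F n) z) (v (z - (x - y))) := by
      intro b
      rw [← smul_eq_mul (a := traceChar F hζ (b ⬝ᵥ _ + _)), inner_smul_right,
        ← mul_assoc, ← AddChar.map_add_eq_mul]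
      congr 2
      rw [dotProduct_comm (z - x)]
      simp only [dotProduct_sub]
      ring
    rw [Finset.sum_congr rfl fun b _ => h b, ← Finset.sum_mul,
      sum_char_dotProduct (traceChar_ne_one hζ) (sub_ne_zero.2 hz), zero_mul]
  · simp

/-- A code of dimension at least two that detects all errors of quantum weight less than `d` has
a minimum distance, which is at least `d`. -/
theorem existsCodeGE_of_detects {ζ : ℂ} (hζ : IsPrimitiveRoot ζ p) {k d : ℕ} (hk : k ≠ 0)
    (Q : Submodule ℂ (State F n)) (hQ : finrank ℂ Q = Fintype.card F ^ k)
    (hdet : ∀ (l : Fin p) (a b : Fin n → F), quantumWeight a b < d →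
      Detects Q (errorOp p ζ l a b)) : ExistsCodeGE F p ζ n k d := by
  classical
  have hex : ∃ w : ℕ, ∃ (l : Fin p) (a b : Fin n → F), quantumWeight a b = w ∧
      ¬ Detects Q (errorOp p ζ l a b) := by
    obtain ⟨l, a, b, h⟩ := exists_not_detects hζ
      (hQ ▸ Nat.one_lt_pow hk Fintype.one_lt_card : 1 < finrank ℂ Q)
    exact ⟨_, l, a, b, rfl, h⟩
  refine ⟨Q, Nat.find hex, ?_, hQ, ?_, Nat.find_spec hex⟩
  · obtain ⟨l, a, b, hw, h⟩ := Nat.find_spec hex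
    by_contra! hlt
    exact h (hdet l a b (hw ▸ hlt))
  · intro l a b hlt
    by_contra h
    exact Nat.find_min hex hlt ⟨l, a, b, rfl, h⟩

/-- The stabilizer construction, for pure codes. -/
theorem existsCodeGE_of_isotropic {ζ : ℂ} (hζ : IsPrimitiveRoot ζ p) (h2 : (2 : F) ≠ 0)
    {k d : ℕ} (hk : k ≠ 0) (S : Submodule F ((Fin n → F) × (Fin n → F)))
    (hS : ∀ s ∈ S, ∀ t ∈ S, symp s t = 0) (hrank : finrank F S + k = n)
    (hdist : ∀ t ≠ 0, (∀ s ∈ S, symp s t = 0) → d ≤ quantumWeight t.1 t.2) :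
    ExistsCodeGE F p ζ n k d := by
  refine existsCodeGE_of_detects hζ hk (LinearMap.range (stabProj (traceChar F hζ) S)) ?_ ?_
  · have h := finrank_range_stabProj h2 (traceChar_ne_one (F := F) hζ) hS
    have h' : Fintype.card F ^ n = Fintype.card F ^ (finrank F S + k) := by rw [hrank]
    rw [h', pow_add] at h
    exact Nat.eq_of_mul_eq_mul_left (pow_pos Fintype.card_pos _) h
  · intro l a b hw
    rw [errorOp_eq_smul_weyl hζ]
    by_cases h0 : (a, b) = 0
    · refine ⟨ζ ^ (l : ℕ) * traceChar F hζ (-(a ⬝ᵥ b / 2)), fun u _ v _ => ?_⟩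
      rw [h0, weyl_zero, LinearMap.smul_apply, inner_smul_right, LinearMap.id_apply]
    · have : ∃ s ∈ S, symp s (a, b) ≠ 0 := by
        by_contra! h
        exact absurd (hdist _ h0 h) (not_le.2 hw)
      obtain ⟨s, hs, hne⟩ := this
      obtain ⟨z, hz⟩ : ∃ z, traceChar F hζ z ≠ 1 := by
        by_contra! h
        exact traceChar_ne_one (F := F) hζ (by ext z; simpa using h z)
      refine ⟨0, ?_⟩
      rintro _ ⟨u, rfl⟩ _ ⟨v, rfl⟩
      -- Since `S` is `F`-linear, `s` can be rescaled until its pairing with the error is `z`, where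
      -- the character is nontrivial.
      have hs' : (z / symp s (a, b)) • s ∈ S := S.smul_mem _ hs
      rw [LinearMap.smul_apply, inner_smul_right, zero_mul,
        inner_weyl_eq_zero h2 _ (s := (z / symp s (a, b)) • s) _
          (weyl_stabProj h2 _ hS hs' u) (weyl_stabProj h2 _ hS hs' v), mul_zero]
      rwa [symp_smul_left, div_mul_cancel₀ _ hne]

end Codes

end QuantumCode

namespace QuantumCode

/-! ### Hermitian self-orthogonal codes and the doubling construction. -/

section Hermitian

variable {K : Type*} [Field K] [StarRing K] {ι ι' : Type*} [Fintype ι] [Fintype ι']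

/-- A linear code of dimension `κ` that is contained in its Hermitian dual, whose nonzero elements
have Hamming weight at least `d`. -/
structure IsHermitianCode [DecidableEq K] (C : Submodule K (ι → K)) (κ d : ℕ) : Prop where
  finrank_eq : finrank K C = κ
  selfOrthogonal : ∀ x ∈ C, ∀ y ∈ C, x ⬝ᵥ star y = 0
  le_hammingNorm : ∀ y ≠ 0, (∀ x ∈ C, x ⬝ᵥ star y = 0) → d ≤ hammingNorm y

variable [DecidableEq K]

theorem IsHermitianCode.reindex {C : Submodule K (ι → K)} {κ d : ℕ} (hC : IsHermitianCode C κ d)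
    (e : ι' ≃ ι) :
    IsHermitianCode (C.map (LinearEquiv.funCongrLeft K K e : (ι → K) →ₗ[K] (ι' → K))) κ d where
  finrank_eq := by
    rw [← hC.finrank_eq]
    exact LinearEquiv.finrank_map_eq (LinearEquiv.funCongrLeft K K e) C
  selfOrthogonal := by
    rintro _ ⟨x, hx, rfl⟩ _ ⟨y, hy, rfl⟩
    rw [← hC.selfOrthogonal x hx y hy]
    exact Equiv.sum_comp e (fun i => x i * star (y i))
  le_hammingNorm := by
    intro y hy hperp
    have h : hammingNorm y = hammingNorm (y ∘ e.symm) := by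
      unfold hammingNorm
      exact Finset.card_equiv e fun i => by simp
    rw [h]
    refine hC.le_hammingNorm _ (fun h0 => hy ?_) fun x hx => ?_
    · ext i
      simpa using congr_fun h0 (e i)
    · rw [← hperp _ ⟨x, hx, rfl⟩]
      refine (Equiv.sum_comp e _).symm.trans ?_
      simp [dotProduct, LinearMap.funLeft]

/-- The construction `{(u + v | u - v)}` for Hermitian self-orthogonal codes. -/
theorem IsHermitianCode.matrixProduct (h2 : (2 : K) ≠ 0) {C₁ C₂ : Submodule K (ι → K)}
    {κ₁ κ₂ d₁ d₂ d : ℕ} (h₁ : IsHermitianCode C₁ κ₁ d₁) (h₂ : IsHermitianCode C₂ κ₂ d₂)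
    (hd₁ : d ≤ 2 * d₁) (hd₂ : d ≤ d₂) :
    ∃ C : Submodule K (ι ⊕ ι → K), IsHermitianCode C (κ₁ + κ₂) d := by
  let φ : (ι → K) × (ι → K) →ₗ[K] (ι ⊕ ι → K) :=
    { toFun := fun u => Sum.elim (u.1 + u.2) (u.1 - u.2)
      map_add' := fun u v => by
        ext (i | i) <;> simp <;> ring
      map_smul' := fun c u => by
        ext (i | i) <;> simp <;> ring }
  have hφ : ∀ u v : ι → K, φ (u, v) = Sum.elim (u + v) (u - v) := fun _ _ => rfl
  have hinj : Function.Injective φ := by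
    rw [← LinearMap.ker_eq_bot, LinearMap.ker_eq_bot']
    rintro ⟨u, v⟩ h
    have hl : ∀ i, u i + v i = 0 := fun i => congr_fun h (Sum.inl i)
    have hr : ∀ i, u i - v i = 0 := fun i => congr_fun h (Sum.inr i)
    refine Prod.ext (funext fun i => ?_) (funext fun i => ?_)
    · refine (mul_eq_zero.1 ?_).resolve_left h2
      linear_combination hl i + hr i
    · refine (mul_eq_zero.1 ?_).resolve_left h2
      linear_combination hl i - hr i
  refine ⟨(C₁.prod C₂).map φ, ?_, ?_, ?_⟩
  · rw [← (Submodule.equivMapOfInjective φ hinj _).finrank_eq,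
      ← h₁.finrank_eq, ← h₂.finrank_eq, ← finrank_prod]
    have hr := LinearMap.range_prodMap C₁.subtype C₂.subtype
    rw [Submodule.range_subtype, Submodule.range_subtype] at hr
    rw [← hr]
    exact LinearMap.finrank_range_of_inj
      (C₁.subtype_injective.prodMap C₂.subtype_injective)
  · rintro _ ⟨⟨u, v⟩, ⟨hu, hv⟩, rfl⟩ _ ⟨⟨u', v'⟩, ⟨hu', hv'⟩, rfl⟩
    have e₁ := h₁.selfOrthogonal u hu u' hu'
    have e₂ := h₂.selfOrthogonal v hv v' hv'
    have hs : star (φ (u', v')) = Sum.elim (star u' + star v') (star u' - star v') := by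
      ext (i | i) <;> simp [hφ]
    rw [hs, hφ, sumElim_dotProduct_sumElim]
    simp only [add_dotProduct, sub_dotProduct, dotProduct_add, dotProduct_sub]
    linear_combination 2 * e₁ + 2 * e₂
  · intro y hy hperp
    obtain ⟨y₁, y₂, rfl⟩ : ∃ y₁ y₂ : ι → K, y = Sum.elim y₁ y₂ :=
      ⟨y ∘ Sum.inl, y ∘ Sum.inr, (Sum.elim_comp_inl_inr y).symm⟩
    have hs : star (Sum.elim y₁ y₂) = Sum.elim (star y₁) (star y₂) := by
      ext (i | i) <;> simp
    have hw : hammingNorm (Sum.elim y₁ y₂) = hammingNorm y₁ + hammingNorm y₂ := by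
      simp only [hammingNorm, Finset.card_filter, Fintype.sum_sum_type, Sum.elim_inl, Sum.elim_inr]
      congr
    have hp₁ : ∀ u ∈ C₁, u ⬝ᵥ star (y₁ + y₂) = 0 := by
      intro u hu
      have h := hperp _ ⟨(u, 0), ⟨hu, C₂.zero_mem⟩, rfl⟩
      rw [hs, hφ, sumElim_dotProduct_sumElim] at h
      simpa [dotProduct_add] using h
    have hp₂ : ∀ v ∈ C₂, v ⬝ᵥ star (y₁ - y₂) = 0 := by
      intro v hv
      have h := hperp _ ⟨(0, v), ⟨C₁.zero_mem, hv⟩, rfl⟩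
      rw [hs, hφ, sumElim_dotProduct_sumElim] at h
      simpa [dotProduct_sub, sub_eq_add_neg] using h
    rw [hw]
    -- Equal halves count the weight twice, giving 2 d₁; otherwise the nonzero difference lies in
    -- the dual of `C₂` and its weight is at most the total.
    by_cases hne : y₁ - y₂ = 0
    · obtain rfl := sub_eq_zero.1 hne
      have h := h₁.le_hammingNorm (y₁ + y₁) ?_ hp₁
      · have : hammingNorm (y₁ + y₁) ≤ hammingNorm y₁ :=
          Finset.card_le_card fun i => by
            simp only [Finset.mem_filter, Finset.mem_univ, true_and, Pi.add_apply]
            intro hi h0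
            simp [h0] at hi
        omega
      · intro h0
        refine hy ?_
        have : y₁ = 0 := funext fun i => by
          have := congr_fun h0 i
          rw [Pi.add_apply, ← two_mul] at this
          exact (mul_eq_zero.1 this).resolve_left h2
        ext (i | i) <;> simp [this]
    · have h := h₂.le_hammingNorm _ hne hp₂
      have : hammingNorm (y₁ - y₂) ≤ hammingNorm y₁ + hammingNorm y₂ := by
        classical
        refine le_trans (Finset.card_le_card fun i => ?_) (Finset.card_union_le _ _)
        simp only [Finset.mem_filter, Finset.mem_univ, true_and, Finset.mem_union, Pi.sub_apply]
        intro hi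
        by_contra! h0
        simp [h0.1, h0.2] at hi
      omega

end Hermitian

/-! ### Hermitian forms as symplectic forms. -/

section Quadratic

variable {F : Type*} [Field F] {ν : F} {n : ℕ}

/-- The pairs `(a, b)` as vectors `a + b ω` over the quadratic extension. -/
def pairEquiv (ν : F) (n : ℕ) :
    ((Fin n → F) × (Fin n → F)) ≃ₗ[F] (Fin n → QuadraticAlgebra F ν 0) where
  toFun s i := ⟨s.1 i, s.2 i⟩
  invFun x := (fun i => (x i).re, fun i => (x i).im)
  map_add' _ _ := rfl
  map_smul' _ _ := rfl
  left_inv _ := rfl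
  right_inv _ := rfl

theorem im_dotProduct_star_pairEquiv (s t : (Fin n → F) × (Fin n → F)) :
    (pairEquiv ν n s ⬝ᵥ star (pairEquiv ν n t)).im = symp s t := by
  have h : ∀ x : Fin n → QuadraticAlgebra F ν 0, (∑ i, x i).im = ∑ i, (x i).im :=
    fun x => map_sum (QuadraticAlgebra.imₗ ν 0) x Finset.univ
  rw [dotProduct, h]
  simp only [symp, dotProduct, ← Finset.sum_sub_distrib]
  refine Finset.sum_congr rfl fun i _ => ?_
  simp [pairEquiv]
  ring

variable [Fintype F] [Fact (∀ r : F, r ^ 2 ≠ ν + 0 * r)]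
  {p : ℕ} [Fact p.Prime] [Algebra (ZMod p) F]

/-- The quantum code of a Hermitian self-orthogonal code. -/
theorem IsHermitianCode.existsCodeGE [DecidableEq (QuadraticAlgebra F ν 0)] {ζ : ℂ}
    (hζ : IsPrimitiveRoot ζ p) (h2 : (2 : F) ≠ 0)
    {C : Submodule (QuadraticAlgebra F ν 0) (Fin n → QuadraticAlgebra F ν 0)} {κ d k : ℕ}
    (hC : IsHermitianCode C κ d) (hk : k ≠ 0) (hn : 2 * κ + k = n) :
    ExistsCodeGE F p ζ n k d := by
  refine existsCodeGE_of_isotropic hζ h2 hk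
    ((C.restrictScalars F).map ((pairEquiv ν n).symm : _ →ₗ[F] _)) ?_ ?_ ?_
  · rintro _ ⟨x, hx, rfl⟩ _ ⟨y, hy, rfl⟩
    rw [← im_dotProduct_star_pairEquiv (ν := ν)]
    simp only [LinearEquiv.coe_coe, LinearEquiv.apply_symm_apply]
    rw [hC.selfOrthogonal x hx y hy, QuadraticAlgebra.im_zero]
  · have h := finrank_mul_finrank F (QuadraticAlgebra F ν 0) C
    rw [QuadraticAlgebra.finrank_eq_two, hC.finrank_eq] at h
    rw [LinearEquiv.finrank_map_eq]
    refine Eq.trans ?_ hn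
    rw [h]
    rfl
  · intro t ht hperp
    classical
    have hw : quantumWeight t.1 t.2 = hammingNorm (pairEquiv ν n t) := by
      rw [quantumWeight, Set.ncard_eq_toFinset_card', hammingNorm]
      congr 1
      ext i
      simp [pairEquiv, QuadraticAlgebra.ext_iff]
    rw [hw]
    have him : ∀ x ∈ C, (x ⬝ᵥ star (pairEquiv ν n t)).im = 0 := by
      intro x hx
      have h := hperp _ ⟨x, hx, rfl⟩
      rw [← im_dotProduct_star_pairEquiv (ν := ν)] at h
      simpa using h
    refine hC.le_hammingNorm _ (by simpa using ht) fun x hx => ?_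
    -- The ω-coordinate of ω z is the real part of z, so 𝕂-linearity upgrades symplectic to
    -- Hermitian orthogonality.
    have h := him _ (C.smul_mem (QuadraticAlgebra.omega) hx)
    rw [smul_dotProduct] at h
    refine QuadraticAlgebra.ext ?_ (him x hx)
    simpa using h

end Quadratic

end QuantumCode

namespace QuantumCode

/-! ### Reed–Solomon codes on the projective line. -/

section ReedSolomon

open Polynomial

variable {K : Type*} [Field K]

/-- Evaluation of polynomials of degree less than `κ` at the points of the projective line. -/
noncomputable def projEval (κ : ℕ) : Option K → K[X] →ₗ[K] K
  | some x => leval x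
  | none => lcoeff K (κ - 1)

@[simp]
theorem projEval_some (κ : ℕ) (x : K) (f : K[X]) : projEval κ (some x) f = f.eval x := rfl

@[simp]
theorem projEval_none (κ : ℕ) (f : K[X]) : projEval κ none f = f.coeff (κ - 1) := rfl

/-- The polynomial of degree less than `κ` that vanishes on the points of a small set `T` but not
at a further point `z`. -/
theorem exists_projEval_ne_zero [DecidableEq K] {κ : ℕ} {z : Option K} {T : Finset (Option K)}
    (hz : z ∉ T) (hT : T.card < κ) :
    ∃ f ∈ degreeLT K κ, (∀ t ∈ T, projEval κ t f = 0) ∧ projEval κ z f ≠ 0 := by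
  let P : K[X] := ∏ x ∈ T.eraseNone, (X - C x)
  have hP : P.Monic := monic_prod_of_monic _ _ fun x _ => monic_X_sub_C x
  have hdeg : P.natDegree = T.eraseNone.card := by
    simp only [P]
    rw [natDegree_prod_of_monic _ _ fun x _ => monic_X_sub_C x]
    simp
  have hroot : ∀ x : K, P.eval x = 0 ↔ some x ∈ T := by
    intro x
    simp only [P, eval_prod, Finset.prod_eq_zero_iff, eval_sub, eval_X, eval_C, sub_eq_zero,
      exists_eq_right', Finset.mem_eraseNone]
  have hcard : T.eraseNone.card ≤ T.card := by
    rw [← Finset.card_map Function.Embedding.some]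
    refine Finset.card_le_card fun t ht => ?_
    obtain ⟨x, hx, rfl⟩ := Finset.mem_map.1 ht
    exact Finset.mem_eraseNone.1 hx
  cases z with
  | none =>
    -- Padding to degree exactly κ - 1 makes the value at infinity the leading coefficient 1.
    have hm : (X ^ (κ - 1 - P.natDegree) * P).Monic := (monic_X_pow _).mul hP
    have hd : (X ^ (κ - 1 - P.natDegree) * P).natDegree = κ - 1 := by
      rw [(monic_X_pow _).natDegree_mul hP, natDegree_X_pow]
      omega
    refine ⟨X ^ (κ - 1 - P.natDegree) * P, ?_, fun t ht => ?_, ?_⟩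
    · rw [mem_degreeLT, degree_eq_natDegree hm.ne_zero, hd]
      exact_mod_cast (by omega : κ - 1 < κ)
    · cases t with
      | none => exact absurd ht hz
      | some x => simp [(hroot x).2 ht]
    · have h := hm.coeff_natDegree
      rw [hd] at h
      rw [projEval_none, h]
      exact one_ne_zero
  | some x =>
    refine ⟨P, ?_, fun t ht => ?_, fun h => hz ((hroot x).1 h)⟩
    · rw [mem_degreeLT, degree_eq_natDegree hP.ne_zero, hdeg]
      exact_mod_cast hcard.trans_lt hT
    · cases t with
      | none =>
        change P.coeff (κ - 1) = 0
        refine coeff_eq_zero_of_natDegree_lt ?_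
        have : T.eraseNone.card < T.card := by
          rw [← Finset.card_map Function.Embedding.some]
          refine Finset.card_lt_card ⟨fun t ht => ?_, fun h => ?_⟩
          · obtain ⟨x, hx, rfl⟩ := Finset.mem_map.1 ht
            exact Finset.mem_eraseNone.1 hx
          · simpa using h ht
        rw [hdeg]
        omega
      | some x => exact (hroot x).2 ht

/-- A generalized Reed–Solomon code on the projective line, with column multipliers `v`, is
Hermitian self-orthogonal as soon as the weights `v * star v` satisfy a system of linear
equations. -/
theorem exists_isHermitianCode_of_weights [StarRing K] [Fintype K] [DecidableEq K] {κ : ℕ}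
    (hκ : κ < Fintype.card K) (v : Option K → K) (hv : ∀ x : K, x ≠ 0 → v (some x) ≠ 0)
    (hsum : ∀ i < κ, ∀ j < κ, ∑ z, v z * star (v z) *
      (projEval κ z (X ^ i) * star (projEval κ z (X ^ j))) = 0) :
    ∃ C : Submodule K ({z : Option K // v z ≠ 0} → K), IsHermitianCode C κ (κ + 1) := by
  let φ : K[X] →ₗ[K] ({z : Option K // v z ≠ 0} → K) :=
    LinearMap.pi fun z => v z • projEval κ (z : Option K)
  have hφ : ∀ f z, φ f z = v z * projEval κ (z : Option K) f := fun _ _ => rfl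
  have hdot : ∀ f g, φ f ⬝ᵥ star (φ g) =
      ∑ z, v z * star (v z) * (projEval κ z f * star (projEval κ z g)) := by
    intro f g
    have h : ∀ z, z ∈ Finset.univ.filter (fun z => v z ≠ 0) ↔ v z ≠ 0 := by simp
    rw [← Finset.sum_filter_of_ne (p := fun z => v z ≠ 0) (fun z _ hz h0 => hz (by simp [h0])),
      Finset.sum_subtype _ h]
    refine Finset.sum_congr rfl fun z _ => ?_
    simp only [Pi.star_apply, hφ, star_mul']
    ring
  have hself : ∀ f ∈ degreeLT K κ, ∀ g ∈ degreeLT K κ, φ f ⬝ᵥ star (φ g) = 0 := by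
    have key : ∀ i < κ, ∀ g ∈ degreeLT K κ, φ (X ^ i) ⬝ᵥ star (φ g) = 0 := by
      intro i hi g hg
      rw [degreeLT_eq_span_X_pow] at hg
      induction hg using Submodule.span_induction with
      | mem g hg =>
        obtain ⟨j, hj, rfl⟩ := by simpa using hg
        rw [hdot]
        exact hsum i hi j hj
      | zero => simp
      | add g g' _ _ h h' => rw [map_add, star_add, dotProduct_add, h, h', add_zero]
      | smul c g _ h => rw [map_smul, star_smul, dotProduct_smul, h, smul_zero]
    intro f hf g hg
    rw [degreeLT_eq_span_X_pow] at hf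
    induction hf using Submodule.span_induction with
    | mem f hf =>
      obtain ⟨i, hi, rfl⟩ := by simpa using hf
      exact key i hi g hg
    | zero => simp
    | add f f' _ _ h h' => rw [map_add, add_dotProduct, h, h', add_zero]
    | smul c f _ h => rw [map_smul, smul_dotProduct, h, smul_zero]
  refine ⟨(degreeLT K κ).map φ, ?_, ?_, ?_⟩
  · have hinj : Function.Injective (φ.domRestrict (degreeLT K κ)) := by
      rw [← LinearMap.ker_eq_bot, LinearMap.ker_eq_bot']
      rintro ⟨f, hf⟩ h
      refine Subtype.ext ?_
      rw [mem_degreeLT] at hf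
      refine eq_zero_of_degree_lt_of_eval_finset_eq_zero (Finset.univ.erase 0)
        (hf.trans_le ?_) fun x hx => ?_
      · rw [Finset.card_erase_of_mem (Finset.mem_univ _), Finset.card_univ]
        exact_mod_cast Nat.le_sub_one_of_lt hκ
      · have hx0 := hv x (Finset.ne_of_mem_erase hx)
        exact (mul_eq_zero.1 (congr_fun h ⟨some x, hx0⟩)).resolve_left hx0
    rw [← LinearMap.range_domRestrict, LinearMap.finrank_range_of_inj hinj,
      (degreeLTEquiv K κ).finrank_eq]
    simp
  · rintro _ ⟨f, hf, rfl⟩ _ ⟨g, hg, rfl⟩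
    exact hself f hf g hg
  · intro y hy hperp
    obtain ⟨z, hz⟩ := Function.ne_iff.1 hy
    by_contra! hlt
    have hzmem : z ∈ Finset.univ.filter (fun i => y i ≠ 0) := by simpa using hz
    -- A dual word of weight at most κ is refuted by a codeword meeting its support only at `z`.
    obtain ⟨f, hf, hT, hne⟩ := exists_projEval_ne_zero (κ := κ) (z := (z : Option K))
      (T := ((Finset.univ.filter (fun i => y i ≠ 0)).erase z).map (Function.Embedding.subtype _))
      (by simp) (by
        rw [Finset.card_map, Finset.card_erase_of_mem hzmem]
        have : (Finset.univ.filter (fun i => y i ≠ 0)).card = hammingNorm y := rfl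
        have := Finset.card_pos.2 ⟨z, hzmem⟩
        omega)
    have h := hperp _ ⟨f, hf, rfl⟩
    rw [dotProduct, Finset.sum_eq_single z] at h
    · rw [hφ, Pi.star_apply] at h
      exact mul_ne_zero (mul_ne_zero z.2 hne) (star_ne_zero.2 hz) h
    · intro i _ hi
      by_cases h0 : y i = 0
      · simp [h0]
      · rw [hφ, hT i (Finset.mem_map.2 ⟨i, by simp [hi, h0], rfl⟩), mul_zero, zero_mul]
    · simp

end ReedSolomon

end QuantumCode

namespace QuantumCode

/-! ### Power sums over 𝕂 and the choice of weights. -/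

section QuadraticExtension

theorem two_ne_zero_of_odd_card {F : Type*} [Field F] [Fintype F] (hF : Odd (Fintype.card F)) :
    (2 : F) ≠ 0 := by
  refine Ring.two_ne_zero fun h => ?_
  have := FiniteField.even_card_of_char_two h
  rw [Nat.odd_iff] at hF
  omega

theorem add_mul_lt_sq_sub_one {q i j : ℕ} (hq : 1 < q) (hi : i < q) (hj : j < q)
    (h : ¬ (i = q - 1 ∧ j = q - 1)) : i + q * j < q ^ 2 - 1 := by
  obtain ⟨r, rfl⟩ := Nat.exists_eq_add_of_le' hq.le
  refine Nat.lt_sub_of_add_lt ?_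
  rw [Nat.add_sub_cancel] at h
  obtain hi' | hj' : i < r ∨ j < r := by omega
  · have hj' : j ≤ r := by omega
    nlinarith
  · nlinarith

variable {F : Type*} [Field F] {ν : F}

local notation "𝕂" => QuadraticAlgebra F ν 0

theorem algebraMap_two_mul_re (x : 𝕂) : algebraMap F 𝕂 (2 * x.re) = x + star x := by
  ext
  · simp
    ring
  · simp

noncomputable instance [Fintype F] : Fintype 𝕂 :=
  Fintype.ofEquiv _ (QuadraticAlgebra.equivProd ν 0).symm

theorem card_quadraticAlgebra [Fintype F] : Fintype.card 𝕂 = Fintype.card F ^ 2 := by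
  rw [card_eq_pow_finrank (K := F) (V := 𝕂), QuadraticAlgebra.finrank_eq_two]

variable [Fact (∀ r : F, r ^ 2 ≠ ν + 0 * r)]

theorem not_isSquare_of_fact : ¬ IsSquare ν := by
  rintro ⟨r, hr⟩
  exact (Fact.out : ∀ r : F, r ^ 2 ≠ ν + 0 * r) r (by rw [hr]; ring)

/-- As a binary quadratic form in the coordinates of `x`, this has discriminant -4ν N(α) = 4ν, a
nonsquare, so it is anisotropic. -/
theorem re_mul_sq_ne_zero {α x : 𝕂} (hα : α * star α = -1) (hx : x ≠ 0) : (α * x ^ 2).re ≠ 0 := by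
  intro h
  have hν := not_isSquare_of_fact (ν := ν)
  have hn : α.re ^ 2 - ν * α.im ^ 2 = -1 := by
    have := congrArg QuadraticAlgebra.re hα
    simp [QuadraticAlgebra.re_one] at this
    linear_combination this
  have hre : α.re * x.re ^ 2 + 2 * ν * α.im * x.re * x.im + ν * α.re * x.im ^ 2 = 0 := by
    rw [sq] at h
    simp at h
    linear_combination h
  have hsq : (α.re * x.re + ν * α.im * x.im) ^ 2 = ν * x.im ^ 2 := by
    linear_combination α.re * hre - ν * x.im ^ 2 * hn
  have him : x.im = 0 := by
    by_contra h0
    refine hν ⟨(α.re * x.re + ν * α.im * x.im) / x.im, ?_⟩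
    field_simp
    linear_combination -hsq
  have hr : x.re ≠ 0 := fun h0 => hx (QuadraticAlgebra.ext h0 him)
  have hα0 : α.re = 0 := by
    rw [him] at hsq
    have : (α.re * x.re) ^ 2 = 0 := by linear_combination hsq
    simpa [hr] using this
  rw [hα0] at hn
  refine hν ⟨ν * α.im, ?_⟩
  linear_combination ν * hn

variable [Fintype F]

/-- Euler's criterion gives ν^((q - 1)/2) = -1, so Frobenius sends ω to -ω. -/
theorem star_eq_pow_card (hF : Odd (Fintype.card F)) (x : 𝕂) : star x = x ^ Fintype.card F := by
  have hchar : ringChar F ≠ 2 := fun h => by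
    have := FiniteField.even_card_of_char_two h
    rw [Nat.odd_iff] at hF
    omega
  have hν : ν ≠ 0 := fun h => not_isSquare_of_fact (ν := ν) (h ▸ ⟨0, by simp⟩)
  have hpow : ν ^ (Fintype.card F / 2) = -1 :=
    (FiniteField.pow_dichotomy hchar hν).resolve_left fun h =>
      not_isSquare_of_fact ((FiniteField.isSquare_iff hchar hν).2 h)
  have hω : (QuadraticAlgebra.omega : 𝕂) ^ Fintype.card F = -QuadraticAlgebra.omega := by
    have h2 : (QuadraticAlgebra.omega : 𝕂) ^ 2 = algebraMap F 𝕂 ν := by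
      rw [sq, QuadraticAlgebra.omega_mul_omega_eq_mk]
      rfl
    rw [← Nat.two_mul_div_two_add_one_of_odd hF, pow_succ, pow_mul, h2, ← map_pow, hpow]
    simp
  have hx : x = algebraMap F 𝕂 x.re + algebraMap F 𝕂 x.im * QuadraticAlgebra.omega := by
    ext <;> simp
  have hfrob := map_add (FiniteField.frobeniusAlgHom F 𝕂) (algebraMap F 𝕂 x.re)
    (algebraMap F 𝕂 x.im * QuadraticAlgebra.omega)
  rw [← hx, map_mul, AlgHom.commutes, AlgHom.commutes, FiniteField.coe_frobeniusAlgHom] at hfrob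
  simp only [hω] at hfrob
  rw [hfrob]
  ext <;> simp

theorem exists_mul_star_eq (hF : Odd (Fintype.card F)) (c : F) :
    ∃ z : 𝕂, z * star z = algebraMap F 𝕂 c := by
  have hν : ν ≠ 0 := fun h => not_isSquare_of_fact (ν := ν) (h ▸ ⟨0, by simp⟩)
  obtain ⟨a, b, hab⟩ := FiniteField.exists_root_sum_quadratic
    (f := Polynomial.X ^ 2 - Polynomial.C c) (g := Polynomial.C (-ν) * Polynomial.X ^ 2)
    (Polynomial.degree_X_pow_sub_C two_pos c)
    (Polynomial.degree_C_mul_X_pow 2 (neg_ne_zero.2 hν)) (Nat.odd_iff.1 hF)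
  simp only [Polynomial.eval_sub, Polynomial.eval_pow, Polynomial.eval_X, Polynomial.eval_C,
    Polynomial.eval_mul] at hab
  refine ⟨⟨a, b⟩, ?_⟩
  ext
  · simp
    linear_combination hab
  · simp
    ring

theorem sum_pow_mul_star_pow (hF : Odd (Fintype.card F)) {i j : ℕ}
    (h : i + Fintype.card F * j < Fintype.card F ^ 2 - 1) :
    ∑ x : 𝕂, x ^ i * star x ^ j = 0 := by
  rw [← FiniteField.sum_pow_lt_card_sub_one (K := 𝕂) (i + Fintype.card F * j)
    (by rwa [card_quadraticAlgebra])]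
  refine Finset.sum_congr rfl fun x _ => ?_
  rw [star_eq_pow_card hF, pow_add, pow_mul]

theorem sum_pow_mul_star_pow' (hF : Odd (Fintype.card F)) {i j : ℕ}
    (h : j + Fintype.card F * i < Fintype.card F ^ 2 - 1) :
    ∑ x : 𝕂, x ^ i * star x ^ j = 0 := by
  have := congrArg star (sum_pow_mul_star_pow (ν := ν) hF h)
  rw [star_sum, star_zero] at this
  rw [← this]
  refine Finset.sum_congr rfl fun x _ => ?_
  simp [mul_comm]

/-- The exponent is (q - 1)(q + 1) = q² - 1, so each of the q² - 1 nonzero elements contributes 1.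
-/
theorem sum_pow_card_mul_star_pow_card (hF : Odd (Fintype.card F)) :
    ∑ x : 𝕂, x ^ (Fintype.card F - 1) * star x ^ (Fintype.card F - 1) = -1 := by
  classical
  have h1 : 1 < Fintype.card F := Fintype.one_lt_card
  have h : ∀ x : 𝕂, x ^ (Fintype.card F - 1) * star x ^ (Fintype.card F - 1) =
      1 - if x = 0 then 1 else 0 := by
    intro x
    split_ifs with hx
    · simp [hx, Nat.sub_ne_zero_of_lt h1]
    · rw [star_eq_pow_card hF, ← pow_mul, ← pow_add, sub_zero,
        ← FiniteField.pow_card_sub_one_eq_one x hx, card_quadraticAlgebra]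
      congr 1
      obtain ⟨m, hm⟩ := Nat.exists_eq_add_of_lt h1
      rw [hm]
      simp only [add_tsub_cancel_right]
      refine (Nat.sub_eq_of_eq_add ?_).symm
      ring
  rw [Finset.sum_congr rfl fun x _ => h x, Finset.sum_sub_distrib]
  have := FiniteField.cast_card_eq_zero 𝕂
  simp [this]

variable [DecidableEq (QuadraticAlgebra F ν 0)]

theorem exists_isHermitianCode_of_norm_weights (hF : Odd (Fintype.card F)) {κ N : ℕ}
    (hκ : κ < Fintype.card F ^ 2) (w : Option 𝕂 → F) (hw : ∀ x : 𝕂, x ≠ 0 → w (some x) ≠ 0)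
    (hsum : ∀ i < κ, ∀ j < κ, ∑ z, algebraMap F 𝕂 (w z) *
      (projEval κ z (.X ^ i) * star (projEval κ z (.X ^ j))) = 0)
    (S : Finset (Option 𝕂)) (hS : ∀ z, w z = 0 ↔ z ∈ S)
    (hN : N + S.card = Fintype.card F ^ 2 + 1) :
    ∃ C : Submodule 𝕂 (Fin N → 𝕂), IsHermitianCode C κ (κ + 1) := by
  choose v hv using fun z => exists_mul_star_eq (ν := ν) hF (w z)
  have hvw : ∀ z, v z = 0 ↔ z ∈ S := by
    intro z
    rw [← hS, ← map_eq_zero (algebraMap F 𝕂), ← hv]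
    simp
  obtain ⟨C, hC⟩ := exists_isHermitianCode_of_weights (hκ.trans_eq card_quadraticAlgebra.symm) v
    (fun x hx h => hw x hx ((hS _).2 ((hvw _).1 h)))
    (fun i hi j hj => by simpa only [hv] using hsum i hi j hj)
  have hcard : Fintype.card {z : Option 𝕂 // v z ≠ 0} = N := by
    rw [Fintype.card_subtype]
    have : Finset.univ.filter (fun z => v z ≠ 0) = Sᶜ := by
      ext z
      simp [hvw]
    rw [this, Finset.card_compl, Fintype.card_option, card_quadraticAlgebra]
    omega
  exact ⟨_, hC.reindex (Fintype.equivFinOfCardEq hcard).symm⟩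

theorem exists_isHermitianCode_card_sq (hF : Odd (Fintype.card F)) {κ : ℕ}
    (hκ : κ < Fintype.card F) :
    ∃ C : Submodule 𝕂 (Fin (Fintype.card F ^ 2) → 𝕂), IsHermitianCode C κ (κ + 1) := by
  refine exists_isHermitianCode_of_norm_weights hF (by nlinarith)
    (fun z => z.elim 0 fun _ => 1) (by simp) (fun i hi j hj => ?_) {none} ?_ (by simp)
  · rw [Fintype.sum_option]
    simp only [Option.elim_none, Option.elim_some, map_zero, map_one, zero_mul, zero_add, one_mul,
      projEval_some, Polynomial.eval_pow, Polynomial.eval_X, star_pow]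
    refine sum_pow_mul_star_pow hF ?_
    refine Nat.lt_sub_of_add_lt ?_
    nlinarith
  · rintro (_ | z) <;> simp

/-- The weight Tr(α x²) with N(α) = -1 vanishes only at 0, and shifts one exponent by 2, which the
bound κ < q still allows. -/
theorem exists_isHermitianCode_card_sq_sub_one (hF : Odd (Fintype.card F)) {κ : ℕ}
    (hκ : κ < Fintype.card F) :
    ∃ C : Submodule 𝕂 (Fin (Fintype.card F ^ 2 - 1) → 𝕂), IsHermitianCode C κ (κ + 1) := by
  have h2 : (2 : F) ≠ 0 := two_ne_zero_of_odd_card hF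
  obtain ⟨α, hα⟩ := exists_mul_star_eq (ν := ν) hF (-1)
  rw [map_neg, map_one] at hα
  refine exists_isHermitianCode_of_norm_weights hF (by nlinarith)
    (fun z => z.elim 0 fun x => 2 * (α * x ^ 2).re)
    (fun x hx => mul_ne_zero h2 (re_mul_sq_ne_zero hα hx)) (fun i hi j hj => ?_)
    {none, some 0} ?_ ?_
  · rw [Fintype.sum_option]
    have e : ∀ x : 𝕂, algebraMap F 𝕂 (2 * (α * x ^ 2).re) * (x ^ i * star x ^ j) =
        α * (x ^ (i + 2) * star x ^ j) + star α * (x ^ i * star x ^ (j + 2)) := by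
      intro x
      rw [algebraMap_two_mul_re, star_mul', star_pow]
      ring
    simp only [Option.elim_none, Option.elim_some, map_zero, zero_mul, zero_add,
      projEval_some, Polynomial.eval_pow, Polynomial.eval_X, star_pow, e]
    rw [Finset.sum_add_distrib, ← Finset.mul_sum, ← Finset.mul_sum, sum_pow_mul_star_pow hF,
      sum_pow_mul_star_pow' hF, mul_zero, mul_zero, add_zero]
    · refine Nat.lt_sub_of_add_lt ?_
      nlinarith
    · refine Nat.lt_sub_of_add_lt ?_
      nlinarith
  · rintro (_ | z)
    · simp
    · by_cases hz : z = 0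
      · simp [hz]
      · simpa [hz, h2] using re_mul_sq_ne_zero hα hz
  · have : 0 < Fintype.card F ^ 2 := pow_pos Fintype.card_pos _
    simp
    omega

theorem exists_isHermitianCode_card_sq_add_one (hF : Odd (Fintype.card F)) {κ : ℕ}
    (hκ : κ ≤ Fintype.card F) :
    ∃ C : Submodule 𝕂 (Fin (Fintype.card F ^ 2 + 1) → 𝕂), IsHermitianCode C κ (κ + 1) := by
  have h2 : (2 : F) ≠ 0 := two_ne_zero_of_odd_card hF
  have h1 : 1 < Fintype.card F := Fintype.one_lt_card
  have hlt : κ < Fintype.card F ^ 2 := by nlinarith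
  have hcoeff : ∀ i < κ, projEval κ (none : Option 𝕂) (.X ^ i) = if i = κ - 1 then 1 else 0 := by
    intro i hi
    simp [Polynomial.coeff_X_pow, eq_comm]
  obtain rfl | hκ0 := Nat.eq_zero_or_pos κ
  · exact exists_isHermitianCode_of_norm_weights hF hlt (fun _ => 1) (by simp) (by simp) ∅
      (by simp) (by simp)
  -- For κ = q constant weights suffice: the only nonzero affine sum, at i = j = q - 1, is -1 and
  -- infinity contributes 1.
  obtain rfl | hκ' := hκ.eq_or_lt
  · refine exists_isHermitianCode_of_norm_weights hF hlt (fun _ => 1) (by simp)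
      (fun i hi j hj => ?_) ∅ (by simp) (by simp)
    rw [Fintype.sum_option]
    simp only [map_one, one_mul, hcoeff i hi, hcoeff j hj, projEval_some, Polynomial.eval_pow,
      Polynomial.eval_X, star_pow]
    by_cases hij : i = Fintype.card F - 1 ∧ j = Fintype.card F - 1
    · rw [hij.1, hij.2, sum_pow_card_mul_star_pow_card hF]
      simp
    · rw [sum_pow_mul_star_pow hF]
      · rw [not_and_or] at hij
        rcases hij with h | h <;> simp [h]
      · exact add_mul_lt_sq_sub_one h1 hi hj hij
  -- With m = q - κ, the weight Tr(x^m)² - ν never vanishes because ν is a nonsquare. Its cross term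
  -- 2 x^m (star x)^m yields -2 exactly at i = j = κ - 1, which the weight 2 at infinity cancels;
  -- all other sums vanish.
  · obtain ⟨m, hm⟩ := Nat.exists_eq_add_of_le hκ
    have hm0 : 0 < m := by omega
    have hw : ∀ x : 𝕂, (2 * (x ^ m).re) ^ 2 - ν ≠ 0 := fun x h =>
      not_isSquare_of_fact (ν := ν) ⟨2 * (x ^ m).re, by linear_combination -h⟩
    have hne : ∀ z : Option 𝕂, z.elim 2 (fun x => (2 * (x ^ m).re) ^ 2 - ν) ≠ 0 := by
      rintro (_ | x)
      · exact h2
      · exact hw x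
    refine exists_isHermitianCode_of_norm_weights hF hlt
      (fun z => z.elim 2 fun x => (2 * (x ^ m).re) ^ 2 - ν) (fun x _ => hw x)
      (fun i hi j hj => ?_) ∅ (fun z => by simpa using hne z) (by simp)
    have e : ∀ x : 𝕂, algebraMap F 𝕂 ((2 * (x ^ m).re) ^ 2 - ν) * (x ^ i * star x ^ j) =
        x ^ (i + 2 * m) * star x ^ j + x ^ i * star x ^ (j + 2 * m) +
          2 * (x ^ (i + m) * star x ^ (j + m)) - algebraMap F 𝕂 ν * (x ^ i * star x ^ j) := by
      intro x
      rw [map_sub, map_pow, algebraMap_two_mul_re, star_pow]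
      ring
    have s₁ : ∑ x : 𝕂, x ^ (i + 2 * m) * star x ^ j = 0 := by
      refine sum_pow_mul_star_pow hF (Nat.lt_sub_of_add_lt ?_)
      rw [hm]
      nlinarith
    have s₂ : ∑ x : 𝕂, x ^ i * star x ^ (j + 2 * m) = 0 := by
      refine sum_pow_mul_star_pow' hF (Nat.lt_sub_of_add_lt ?_)
      rw [hm]
      nlinarith
    have s₃ : ∑ x : 𝕂, x ^ i * star x ^ j = 0 := by
      refine sum_pow_mul_star_pow hF (Nat.lt_sub_of_add_lt ?_)
      rw [hm]
      nlinarith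
    rw [Fintype.sum_option]
    simp only [Option.elim_none, Option.elim_some, map_ofNat, hcoeff i hi, hcoeff j hj,
      projEval_some, Polynomial.eval_pow, Polynomial.eval_X, star_pow, e]
    rw [Finset.sum_sub_distrib, Finset.sum_add_distrib, Finset.sum_add_distrib, s₁, s₂,
      ← Finset.mul_sum, ← Finset.mul_sum, s₃]
    by_cases hij : i + m = Fintype.card F - 1 ∧ j + m = Fintype.card F - 1
    · rw [hij.1, hij.2, sum_pow_card_mul_star_pow_card hF, if_pos (by omega), if_pos (by omega)]
      simp
    · rw [sum_pow_mul_star_pow hF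
        (add_mul_lt_sq_sub_one h1 (by omega : i + m < _) (by omega : j + m < _) hij)]
      have : ¬ (i = κ - 1 ∧ j = κ - 1) := fun h => hij (by omega)
      rw [not_and_or] at this
      rcases this with h | h <;> simp [h]

end QuadraticExtension

end QuantumCode

/-! ### Assembling the six families. -/

namespace QuantumCode

/-- Quantum codes of length `2 N` from Hermitian self-orthogonal MDS codes of length `N`. -/
theorem existsCodeGE_two_mul {F : Type*} [Field F] [Fintype F] {p : ℕ} [Fact p.Prime]
    [Algebra (ZMod p) F] {ζ : ℂ} (hζ : IsPrimitiveRoot ζ p) (h2 : (2 : F) ≠ 0) {ν : F}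
    [Fact (∀ r : F, r ^ 2 ≠ ν + 0 * r)] [DecidableEq (QuadraticAlgebra F ν 0)] {N d k : ℕ}
    (hC : ∀ κ < d, ∃ C : Submodule (QuadraticAlgebra F ν 0) (Fin N → QuadraticAlgebra F ν 0),
      IsHermitianCode C κ (κ + 1))
    (hd : 0 < d) (hk : k ≠ 0) (hN : 2 * ((d - 1) / 2 + (d - 1)) + k = 2 * N) :
    ExistsCodeGE F p ζ (2 * N) k d := by
  -- ⌊(d - 1)/2⌋ is the least κ with 2(κ + 1) ≥ d; for d = 2 it is the zero code.
  obtain ⟨C₁, h₁⟩ := hC ((d - 1) / 2) (by omega)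
  obtain ⟨C₂, h₂⟩ := hC (d - 1) (by omega)
  have hK : (2 : QuadraticAlgebra F ν 0) ≠ 0 := fun h => h2 (congrArg QuadraticAlgebra.re h)
  obtain ⟨C, h⟩ := h₁.matrixProduct hK h₂ (d := d) (by omega) (by omega)
  exact (h.reindex ((finCongr (two_mul N)).trans finSumFinEquiv.symm)).existsCodeGE hζ h2 hk hN

end QuantumCode

theorem mainTheorem5 (F : Type*) [Field F] [Fintype F] (p : ℕ) [Fact p.Prime]
    [Algebra (ZMod p) F] (ζ : ℂ) (hζ : IsPrimitiveRoot ζ p)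
    (q : ℕ) (hq : Fintype.card F = q) (hodd : Odd q) :
    (∀ d : ℕ, 2 ≤ d → d ≤ q + 1 → Even d →
      QuantumCode.ExistsCodeGE F p ζ (2 * q ^ 2 + 2) (2 * q ^ 2 + 6 - 3 * d) d) ∧
    (∀ d : ℕ, 2 ≤ d → d ≤ q + 1 → Odd d →
      QuantumCode.ExistsCodeGE F p ζ (2 * q ^ 2 + 2) (2 * q ^ 2 + 5 - 3 * d) d) ∧
    (∀ d : ℕ, 2 ≤ d → d ≤ q → Even d →
      QuantumCode.ExistsCodeGE F p ζ (2 * q ^ 2) (2 * q ^ 2 + 4 - 3 * d) d) ∧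
    (∀ d : ℕ, 2 ≤ d → d ≤ q → Odd d →
      QuantumCode.ExistsCodeGE F p ζ (2 * q ^ 2) (2 * q ^ 2 + 3 - 3 * d) d) ∧
    (∀ d : ℕ, 2 ≤ d → d ≤ q → Even d →
      QuantumCode.ExistsCodeGE F p ζ (2 * q ^ 2 - 2) (2 * q ^ 2 + 2 - 3 * d) d) ∧
    (∀ d : ℕ, 2 ≤ d → d ≤ q → Odd d →
      QuantumCode.ExistsCodeGE F p ζ (2 * q ^ 2 - 2) (2 * q ^ 2 + 1 - 3 * d) d) := by
  classical
  subst hq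
  have h2 := QuantumCode.two_ne_zero_of_odd_card hodd
  have h1 : 1 < Fintype.card F := Fintype.one_lt_card
  -- Odd q is at least 3; this keeps every code dimension exponent positive, so no subtraction
  -- truncates.
  have hsq : 3 * Fintype.card F ≤ Fintype.card F ^ 2 := by
    obtain ⟨m, hm⟩ := hodd
    rw [sq]
    exact Nat.mul_le_mul_right _ (by omega)
  have hchar : ringChar F ≠ 2 := fun h => by
    have := FiniteField.even_card_of_char_two h
    rw [Nat.odd_iff] at hodd
    omega
  obtain ⟨ν, hν⟩ := FiniteField.exists_nonsquare hchar
  have : Fact (∀ r : F, r ^ 2 ≠ ν + 0 * r) := ⟨fun r hr => hν ⟨r, by linear_combination -hr⟩⟩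
  have e₁ : 2 * Fintype.card F ^ 2 + 2 = 2 * (Fintype.card F ^ 2 + 1) := by ring
  have e₂ : 2 * Fintype.card F ^ 2 - 2 = 2 * (Fintype.card F ^ 2 - 1) := by omega
  have hA : ∀ d ≤ Fintype.card F + 1, ∀ κ < d, _ := fun d hd κ hκ =>
    QuantumCode.exists_isHermitianCode_card_sq_add_one (ν := ν) hodd (κ := κ) (by omega)
  have hB : ∀ d ≤ Fintype.card F, ∀ κ < d, _ := fun d hd κ hκ =>
    QuantumCode.exists_isHermitianCode_card_sq (ν := ν) hodd (κ := κ) (by omega)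
  have hC : ∀ d ≤ Fintype.card F, ∀ κ < d, _ := fun d hd κ hκ =>
    QuantumCode.exists_isHermitianCode_card_sq_sub_one (ν := ν) hodd (κ := κ) (by omega)
  rw [e₁, e₂]
  refine ⟨?_, ?_, ?_, ?_, ?_, ?_⟩ <;> rintro d hd hdq ⟨t, rfl⟩
  · exact QuantumCode.existsCodeGE_two_mul hζ h2 (hA _ hdq) (by omega) (by omega) (by omega)
  · exact QuantumCode.existsCodeGE_two_mul hζ h2 (hA _ hdq) (by omega) (by omega) (by omega)
  · exact QuantumCode.existsCodeGE_two_mul hζ h2 (hB _ hdq) (by omega) (by omega) (by omega)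
  · exact QuantumCode.existsCodeGE_two_mul hζ h2 (hB _ hdq) (by omega) (by omega) (by omega)
  · exact QuantumCode.existsCodeGE_two_mul hζ h2 (hC _ hdq) (by omega) (by omega) (by omega)
  · exact QuantumCode.existsCodeGE_two_mul hζ h2 (hC _ hdq) (by omega) (by omega) (by omega)
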